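/- Let $W=(W(t))_{t\ge 0}$ be a standard Brownian motion started at $0$, let $\rho>0$, $x_0>0$ and $\beta>0$ be constants, and for each $n\ge 1$ let $\sigma=\sigma_n>0$ and $\tau=\tau_n>0$ satisfy $\tfrac12\sigma^2\tau n^2=\beta$. Put $t_i=i\tau$ and $$a_i=1+\rho\, e^{\sigma W(t_i)-\frac12\sigma^2 t_i},\qquad i\ge 0 .$$ Let $(b_i)_{i\ge 0}$ be i.i.d. nonnegative random variables (whose law does not depend on $n$), independent of $(a_i)_{i\ge 0}$, and let $x_n$ be the $n$-th term of the linear recursion $x_{i+1}=a_ix_i+b_i$ started at $x_0$, built with the parameters $\sigma_n,\tau_n$. Let $q\ge 1$ be an integer with $\mathbb{E}[b_0^q]<\infty$. Then $\mathbb{E}[(x_n)^q]<\infty$ for all $n\ge1$, and, as $n\to\infty$ with $\rho$, $x_0$, $\beta$, $q$ fixed, $$\lim_{n\to\infty}\frac1n\log\mathbb{E}[(x_n)^q]=\lambda(\rho,\beta;q),$$ where $\lambda(\rho,\beta;q)$ is the Lyapunov exponent of the recursion without additive noise: if $y_n=x_0\prod_{i=0}^{n-1}a_i$ (the case $b_i\equiv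 0$, with the same parameters $\sigma_n,\tau_n$), then also $\mathbb{E}[(y_n)^q]<\infty$ for all $n\ge 1$ and $\lim_{n\to\infty}\frac1n\log\mathbb{E}[(y_n)^q]=\lambda(\rho,\beta;q)$. Here $$\lambda(\rho,\beta;q)=\sup_{g\in\mathcal{G}_q}\left\{g(1)\log\rho+\beta\int_0^1(g(1)-g(x))^2\,dx-q\int_0^1 I\!\left(\frac{g'(x)}{q}\right)dx\right\},$$ with $I(x)=x\log x+(1-x)\log(1-x)$ (and $0\log 0=0$), and $\mathcal{G}_q$ the set of absolutely continuous $g:[0,1]\to[0,q]$ with $g(0)=0$ and $0\le g'\le q$ almost everywhere. -/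

import Mathlib

open MeasureTheory ProbabilityTheory Filter Topology
open scoped NNReal

noncomputable section

namespace LinRec

/-- The multiplier `a_i = 1 + ρ exp (σ W_i - σ² t_i / 2)`, where `W_i = W (t_i)` and `t_i = i τ`. -/
def multiplier {Ω : Type*} (W : ℝ≥0 → Ω → ℝ) (ρ σ : ℝ) (τ : ℝ≥0) (i : ℕ) (ω : Ω) : ℝ :=
  1 + ρ * Real.exp (σ * W ((i : ℝ≥0) * τ) ω - 1 / 2 * σ ^ 2 * ((i : ℝ) * (τ : ℝ)))

/-- The solution of `x_{i+1} = a_i x_i + b_i` started from `x_0`. -/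
def recursion (x₀ : ℝ) (a b : ℕ → ℝ) : ℕ → ℝ
  | 0 => x₀
  | i + 1 => a i * recursion x₀ a b i + b i

/-- `I(x) = x log x + (1 - x) log (1 - x)` (with `0 log 0 = 0`). -/
def entropyFun (x : ℝ) : ℝ :=
  x * Real.log x + (1 - x) * Real.log (1 - x)

/-- The set of functions `g : [0,1] → [0,q]` which are absolutely continuous, with `g 0 = 0` and
`0 ≤ g' ≤ q` almost everywhere. (Values of `g` outside `[0,1]` play no role.) -/
def admissible (q : ℕ) : Set (ℝ → ℝ) :=
  {g | AbsolutelyContinuousOnInterval g 0 1 ∧ g 0 = 0 ∧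
    (∀ x ∈ Set.Icc (0 : ℝ) 1, g x ∈ Set.Icc (0 : ℝ) q) ∧
    ∀ᵐ x : ℝ, x ∈ Set.Ioo (0 : ℝ) 1 → deriv g x ∈ Set.Icc (0 : ℝ) q}

/-- The functional
`g(1) log ρ + β ∫₀¹ (g(1) - g(x))² dx - q ∫₀¹ I(g'(x) / q) dx`. -/
def functional (ρ β : ℝ) (q : ℕ) (g : ℝ → ℝ) : ℝ :=
  g 1 * Real.log ρ + β * (∫ x in (0 : ℝ)..1, (g 1 - g x) ^ 2)
    - q * ∫ x in (0 : ℝ)..1, entropyFun (deriv g x / q)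

/-- The Lyapunov exponent `λ(ρ, β; q)`: the supremum of `functional ρ β q` over `admissible q`.
The set of values is nonempty and bounded above, see below. -/
def lyapunovExponent (ρ β : ℝ) (q : ℕ) : ℝ :=
  sSup (functional ρ β q '' admissible q)

lemma functional_image_nonempty (ρ β : ℝ) (q : ℕ) :
    (functional ρ β q '' admissible q).Nonempty := by
  refine ⟨_, fun _ => 0, ⟨?_, rfl, ?_, ?_⟩, rfl⟩
  · exact ((LipschitzWith.const (0 : ℝ)).lipschitzOnWith
      (s := Set.uIcc (0 : ℝ) 1)).absolutelyContinuousOnInterval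
  · intro x _
    simp
  · simp

lemma abs_entropyFun_le {x : ℝ} (h0 : 0 ≤ x) (h1 : x ≤ 1) :
    |entropyFun x| ≤ Real.log 2 := by
  have h : entropyFun x = - Real.binEntropy x := by
    simp only [entropyFun, Real.binEntropy, Real.log_inv]
    ring
  rw [h, abs_neg, abs_of_nonneg (Real.binEntropy_nonneg h0 h1)]
  exact Real.binEntropy_le_log_two

lemma functional_image_bddAbove (ρ β : ℝ) (q : ℕ) :
    BddAbove (functional ρ β q '' admissible q) := by
  refine ⟨q * |Real.log ρ| + |β| * (q : ℝ) ^ 2 + q * Real.log 2, ?_⟩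
  rintro _ ⟨g, ⟨-, -, hg, hd⟩, rfl⟩
  have h1 := hg 1 (by simp)
  have hA : g 1 * Real.log ρ ≤ q * |Real.log ρ| :=
    (mul_le_mul_of_nonneg_left (le_abs_self _) h1.1).trans
      (mul_le_mul_of_nonneg_right h1.2 (abs_nonneg _))
  have hB : |∫ x in (0 : ℝ)..1, (g 1 - g x) ^ 2| ≤ (q : ℝ) ^ 2 := by
    have := intervalIntegral.norm_integral_le_of_norm_le_const (a := (0 : ℝ)) (b := 1)
      (f := fun x => (g 1 - g x) ^ 2) (C := (q : ℝ) ^ 2) (by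
        intro x hx
        rw [Set.uIoc_of_le zero_le_one] at hx
        have h2 := hg x ⟨hx.1.le, hx.2⟩
        rw [Real.norm_eq_abs, abs_pow]
        exact pow_le_pow_left₀ (abs_nonneg _)
          (abs_le.2 ⟨by linarith [h1.1, h2.2], by linarith [h1.2, h2.1]⟩) 2)
    simpa using this
  have hC : |∫ x in (0 : ℝ)..1, entropyFun (deriv g x / q)| ≤ Real.log 2 := by
    have := intervalIntegral.norm_integral_le_of_norm_le_const_ae (a := (0 : ℝ)) (b := 1)
      (f := fun x => entropyFun (deriv g x / q)) (C := Real.log 2) (by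
        have hne : ∀ᵐ x : ℝ, x ≠ 1 := by simp [ae_iff]
        filter_upwards [hd, hne] with x hx hx1 hxI
        rw [Set.uIoc_of_le zero_le_one] at hxI
        have h2 := hx ⟨hxI.1, lt_of_le_of_ne hxI.2 hx1⟩
        exact abs_entropyFun_le (div_nonneg h2.1 (Nat.cast_nonneg q))
          (div_le_one_of_le₀ h2.2 (Nat.cast_nonneg q)))
    simpa using this
  have hB' : β * (∫ x in (0 : ℝ)..1, (g 1 - g x) ^ 2) ≤ |β| * (q : ℝ) ^ 2 := by
    refine (le_abs_self _).trans ?_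
    rw [abs_mul]
    exact mul_le_mul_of_nonneg_left hB (abs_nonneg _)
  have hC' : -((q : ℝ) * ∫ x in (0 : ℝ)..1, entropyFun (deriv g x / q)) ≤ q * Real.log 2 := by
    rw [← mul_neg]
    exact mul_le_mul_of_nonneg_left ((neg_le_abs _).trans hC) (Nat.cast_nonneg q)
  unfold functional
  linarith

end LinRec

end

/-! Put `c = σ²τ/2 = β/n²`. Expanding `(∏ a_i)^q` by the binomial theorem and writing the Brownian
values as sums of independent Gaussian increments gives `∑_k w(k) exp (c ∑_m (S_m² - S_m))`, where
`S_m` is the sum of the `k_i` with `i > m`. As `S_m ≤ qn`, dropping the linear term costs at most a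
factor `exp (βq)`, and there remains the partition function of a model with quadratic interaction.

The interaction is linearized by `S² = max_θ (2θS - θ²)`. For a fixed profile `θ` the sum over `k`
factorizes, and it bounds the partition function from below. Conversely, `S` varies by at most `q`
per step, so profiles constant on blocks of length about `√n` suffice for an upper bound: freezing
`S` on blocks costs `O(1)` in the logarithm, and the number of profiles contributes only `O(√n log
n)`.

The factorized sums are compared with the functional through the duality `log (1 + e^u) = max_r (r u
- I(r))`. For the lower bound, `θ` is read off an admissible `g` and the Gibbs inequality is
integrated over each cell. For the upper bound, the maximizers `r_i` are the slopes, divided by `q`,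
of a piecewise linear admissible `g`. See `mul_functional_sub_le_log_partitionFun`,
`log_linearizedPartitionFun_le` and `partitionFun_le_of_linearized_le`.

The additive noise does not matter: since `a_i ≥ 1`, one has `y_n ≤ x_n ≤ (∏ a_i) (x₀ + ∑ b_i)`, and
by independence the last factor changes the moment only polynomially in `n`. -/

namespace LinRec

/-! ### Partition functions with quadratic and linearized interaction -/

noncomputable section

/-- The set of multi-indices `k : Fin n → {0, …, q}`. -/
def multiIndices (q n : ℕ) : Finset (Fin n → ℕ) :=
  Fintype.piFinset fun _ => Finset.range (q + 1)

/-- The weight `∏ C(q, k_i) ρ ^ k_i` of a multi-index. -/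
def weight (ρ : ℝ) (q : ℕ) {n : ℕ} (k : Fin n → ℕ) : ℝ :=
  ∏ i, ((q.choose (k i) : ℝ) * ρ ^ k i)

/-- The tail sum `∑_{i > m} k_i`. -/
def tailSum {n : ℕ} (k : Fin n → ℕ) (m : ℕ) : ℕ :=
  ∑ i : Fin n, if m < (i : ℕ) then k i else 0

/-- The partition function `∑_k w(k) exp (c ∑_m (∑_{i > m} k_i)²)`. -/
def partitionFun (ρ c : ℝ) (q n : ℕ) : ℝ :=
  ∑ k ∈ multiIndices q n, weight ρ q k *
    Real.exp (c * ∑ m ∈ Finset.range n, (tailSum k m : ℝ) ^ 2)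

/-- The partition function with the quadratic interaction linearized around `θ`. -/
def linearizedPartitionFun (ρ c : ℝ) (q n : ℕ) (θ : ℕ → ℝ) : ℝ :=
  Real.exp (-(c * ∑ m ∈ Finset.range n, θ m ^ 2)) *
    ∏ i ∈ Finset.range n,
      (1 + ρ * Real.exp (2 * c * ∑ m ∈ Finset.range i, θ m)) ^ q

lemma weight_nonneg {ρ : ℝ} (hρ : 0 ≤ ρ) (q : ℕ) {n : ℕ} (k : Fin n → ℕ) :
    0 ≤ weight ρ q k :=
  Finset.prod_nonneg fun _ _ => by positivity

lemma tailSum_le {q n : ℕ} {k : Fin n → ℕ} (hk : k ∈ multiIndices q n) (m : ℕ) :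
    tailSum k m ≤ q * n := by
  have hk' : ∀ i, k i ≤ q := fun i => by
    have := Fintype.mem_piFinset.1 hk i
    rw [Finset.mem_range] at this
    omega
  calc tailSum k m ≤ ∑ _i : Fin n, q := by
        refine Finset.sum_le_sum fun i _ => ?_
        split_ifs
        · exact hk' i
        · exact Nat.zero_le _
    _ = q * n := by simp [mul_comm]

/-- Only the indices in `(l, m]` are lost, each contributing at most `q`. This bounds the error of
freezing the tail sum on a block. -/
lemma tailSum_le_add {q n : ℕ} {k : Fin n → ℕ} (hk : k ∈ multiIndices q n)
    (l m : ℕ) : tailSum k l ≤ tailSum k m + q * (m - l) := by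
  have hk' : ∀ i, k i ≤ q := fun i => by
    have := Fintype.mem_piFinset.1 hk i
    rw [Finset.mem_range] at this
    omega
  have h : tailSum k l ≤ tailSum k m + ∑ i : Fin n, if l < (i : ℕ) ∧ (i : ℕ) ≤ m then q else 0 := by
    unfold tailSum
    rw [← Finset.sum_add_distrib]
    refine Finset.sum_le_sum fun i _ => ?_
    have := hk' i
    split_ifs <;> omega
  refine h.trans (Nat.add_le_add_left ?_ _)
  rw [← Finset.sum_filter, Finset.sum_const, smul_eq_mul, mul_comm]
  refine Nat.mul_le_mul_left _ ?_
  calc (Finset.univ.filter fun i : Fin n => l < (i : ℕ) ∧ (i : ℕ) ≤ m).card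
      ≤ (Finset.Ioc l m).card := by
        refine Finset.card_le_card_of_injOn (fun i => (i : ℕ)) ?_ (Fin.val_injective.injOn)
        intro i hi
        simpa using hi
    _ = m - l := Nat.card_Ioc _ _

lemma tailSum_anti {n : ℕ} (k : Fin n → ℕ) {l m : ℕ} (hlm : l ≤ m) :
    tailSum k m ≤ tailSum k l := by
  refine Finset.sum_le_sum fun i _ => ?_
  split_ifs <;> omega

/-- Summation by parts: the pairs `m < i` are summed in the other order. -/
lemma sum_mul_sum_range_eq {n : ℕ} (k : Fin n → ℕ) (f : ℕ → ℝ) :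
    ∑ i : Fin n, (k i : ℝ) * ∑ m ∈ Finset.range (i : ℕ), f m =
      ∑ m ∈ Finset.range n, (tailSum k m : ℝ) * f m := by
  have h : ∀ i : Fin n, (k i : ℝ) * ∑ m ∈ Finset.range i, f m =
      ∑ m ∈ Finset.range n, if m < (i : ℕ) then (k i : ℝ) * f m else 0 := by
    intro i
    rw [Finset.mul_sum, ← Finset.sum_filter]
    refine Finset.sum_congr ?_ fun _ _ => rfl
    ext m
    have := i.2
    simp only [Finset.mem_range, Finset.mem_filter]
    omega
  simp_rw [h]
  rw [Finset.sum_comm]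
  refine Finset.sum_congr rfl fun m _ => ?_
  rw [tailSum, Nat.cast_sum, Finset.sum_mul]
  refine Finset.sum_congr rfl fun i _ => ?_
  split_ifs <;> simp

lemma prod_one_add_mul_exp_pow (ρ : ℝ) (q n : ℕ) (u : ℕ → ℝ) :
    ∏ i ∈ Finset.range n, (1 + ρ * Real.exp (u i)) ^ q =
      ∑ k ∈ multiIndices q n, weight ρ q k * Real.exp (∑ i : Fin n, (k i : ℝ) * u i) := by
  have h : ∀ i : Fin n, (1 + ρ * Real.exp (u i)) ^ q =
      ∑ j ∈ Finset.range (q + 1), ((q.choose j : ℝ) * ρ ^ j) * Real.exp ((j : ℝ) * u i) := by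
    intro i
    rw [add_comm, add_pow]
    refine Finset.sum_congr rfl fun j _ => ?_
    rw [mul_pow, ← Real.exp_nat_mul]
    simp only [one_pow]
    ring
  rw [← Fin.prod_univ_eq_prod_range (fun i => (1 + ρ * Real.exp (u i)) ^ q)]
  simp_rw [h]
  rw [Finset.prod_univ_sum]
  refine Finset.sum_congr rfl fun k _ => ?_
  rw [Finset.prod_mul_distrib, Real.exp_sum]
  rfl

/-- An exponent linear in the tail sums is linear in each `k_i`, so the sum over `k` is a product of
binomial sums. -/
lemma linearizedPartitionFun_eq_sum (ρ c : ℝ) (q n : ℕ) (θ : ℕ → ℝ) :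
    linearizedPartitionFun ρ c q n θ = ∑ k ∈ multiIndices q n, weight ρ q k *
      Real.exp (c * ∑ m ∈ Finset.range n, (2 * θ m * tailSum k m - θ m ^ 2)) := by
  rw [linearizedPartitionFun, prod_one_add_mul_exp_pow, Finset.mul_sum]
  refine Finset.sum_congr rfl fun k _ => ?_
  have h : ∑ i : Fin n, (k i : ℝ) * (2 * c * ∑ m ∈ Finset.range i, θ m) =
      2 * c * ∑ m ∈ Finset.range n, (tailSum k m : ℝ) * θ m := by
    rw [← sum_mul_sum_range_eq, Finset.mul_sum]
    exact Finset.sum_congr rfl fun i _ => by ring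
  rw [h, mul_left_comm, ← Real.exp_add, Finset.sum_sub_distrib]
  congr 2
  simp_rw [Finset.mul_sum, mul_sub, Finset.mul_sum]
  rw [neg_add_eq_sub]
  congr 1
  exact Finset.sum_congr rfl fun i _ => by ring

lemma linearizedPartitionFun_pos {ρ : ℝ} (hρ : 0 ≤ ρ) (c : ℝ) (q n : ℕ) (θ : ℕ → ℝ) :
    0 < linearizedPartitionFun ρ c q n θ :=
  mul_pos (Real.exp_pos _) (Finset.prod_pos fun _ _ => by positivity)

lemma linearizedPartitionFun_le {ρ c : ℝ} (hρ : 0 ≤ ρ) (hc : 0 ≤ c) (q n : ℕ) (θ : ℕ → ℝ) :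
    linearizedPartitionFun ρ c q n θ ≤ partitionFun ρ c q n := by
  rw [linearizedPartitionFun_eq_sum]
  refine Finset.sum_le_sum fun k _ => mul_le_mul_of_nonneg_left ?_ (weight_nonneg hρ q k)
  gcongr with m
  nlinarith [sq_nonneg ((tailSum k m : ℝ) - θ m)]

lemma partitionFun_pos {ρ c : ℝ} (hρ : 0 ≤ ρ) (hc : 0 ≤ c) (q n : ℕ) :
    0 < partitionFun ρ c q n :=
  (linearizedPartitionFun_pos hρ c q n 0).trans_le (linearizedPartitionFun_le hρ hc q n 0)

/-- The profiles that are constant on blocks of length `B`, with values in `{0, …, qn}`, suffice to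
dominate the partition function by linearized ones. -/
lemma partitionFun_le_of_linearized_le {ρ c M : ℝ} (hρ : 0 ≤ ρ) (hc : 0 ≤ c) {q n B : ℕ}
    (hB : 0 < B) (hM : ∀ θ : ℕ → ℝ, linearizedPartitionFun ρ c q n θ ≤ M) :
    partitionFun ρ c q n ≤
      Real.exp (c * (n * (q * B : ℝ) ^ 2)) * ((q * n + 1 : ℝ) ^ (n / B + 1) * M) := by
  classical
  -- The reduction modulo `n / B + 1` in `Fin.ofNat` is harmless, since `m / B ≤ n / B` for `m < n`.
  let prof : (Fin (n / B + 1) → Fin (q * n + 1)) → ℕ → ℝ := fun t m =>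
    (t (Fin.ofNat (n / B + 1) (m / B)) : ℕ)
  have key : ∀ k ∈ multiIndices q n, ∃ t : Fin (n / B + 1) → Fin (q * n + 1),
      c * ∑ m ∈ Finset.range n, (tailSum k m : ℝ) ^ 2 ≤ c * (n * (q * B : ℝ) ^ 2) +
        c * ∑ m ∈ Finset.range n, (2 * prof t m * tailSum k m - prof t m ^ 2) := by
    intro k hk
    -- The profile is the tail sum at the left end of each block. The error in `S² = 2θS - θ² + (θ -
    -- S)²` is then at most `(qB)²` per site.
    refine ⟨fun j => ⟨tailSum k (j * B), Nat.lt_succ_of_le (tailSum_le hk _)⟩, ?_⟩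
    rw [← mul_add]
    refine mul_le_mul_of_nonneg_left ?_ hc
    have hn : (n : ℝ) * (q * B : ℝ) ^ 2 = ∑ m ∈ Finset.range n, (q * B : ℝ) ^ 2 := by simp
    rw [hn, ← Finset.sum_add_distrib]
    refine Finset.sum_le_sum fun m hm => ?_
    have hmn := Finset.mem_range.1 hm
    have hdiv : m / B % (n / B + 1) = m / B :=
      Nat.mod_eq_of_lt (Nat.lt_succ_of_le (Nat.div_le_div_right hmn.le))
    simp only [prof, Fin.val_ofNat, hdiv]
    have hle : m / B * B ≤ m := Nat.div_mul_le_self m B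
    have h1 : tailSum k m ≤ tailSum k (m / B * B) := tailSum_anti k hle
    have h2 : tailSum k (m / B * B) ≤ tailSum k m + q * B := by
      refine (tailSum_le_add hk _ _).trans (Nat.add_le_add_left (Nat.mul_le_mul_left _ ?_) _)
      have := Nat.div_add_mod' m B
      have := Nat.mod_lt m hB
      omega
    have h1' : (tailSum k m : ℝ) ≤ tailSum k (m / B * B) := by exact_mod_cast h1
    have h2' : (tailSum k (m / B * B) : ℝ) ≤ tailSum k m + q * B := by exact_mod_cast h2
    have h3 : ((tailSum k (m / B * B) : ℝ) - tailSum k m) ^ 2 ≤ (q * B : ℝ) ^ 2 :=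
      pow_le_pow_left₀ (by linarith) (by linarith) 2
    nlinarith [h3]
  calc partitionFun ρ c q n
      ≤ ∑ k ∈ multiIndices q n, ∑ t : Fin (n / B + 1) → Fin (q * n + 1),
          Real.exp (c * (n * (q * B : ℝ) ^ 2)) * (weight ρ q k * Real.exp
            (c * ∑ m ∈ Finset.range n, (2 * prof t m * tailSum k m - prof t m ^ 2))) := by
        refine Finset.sum_le_sum fun k hk => ?_
        obtain ⟨t, ht⟩ := key k hk
        have hw := weight_nonneg hρ q k
        refine le_trans ?_ (Finset.single_le_sum
          (f := fun t => Real.exp (c * (n * (q * B : ℝ) ^ 2)) * (weight ρ q k * Real.exp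
            (c * ∑ m ∈ Finset.range n, (2 * prof t m * tailSum k m - prof t m ^ 2))))
          (fun t _ => by positivity) (Finset.mem_univ t))
        rw [mul_left_comm, ← Real.exp_add]
        exact mul_le_mul_of_nonneg_left (Real.exp_le_exp.2 ht) hw
    _ = Real.exp (c * (n * (q * B : ℝ) ^ 2)) * ∑ t : Fin (n / B + 1) → Fin (q * n + 1),
          linearizedPartitionFun ρ c q n (prof t) := by
        rw [Finset.sum_comm, Finset.mul_sum]
        refine Finset.sum_congr rfl fun t _ => ?_
        rw [linearizedPartitionFun_eq_sum, Finset.mul_sum]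
    _ ≤ _ := by
        refine mul_le_mul_of_nonneg_left ?_ (Real.exp_pos _).le
        refine (Finset.sum_le_card_nsmul _ _ M fun t _ => hM (prof t)).trans (le_of_eq ?_)
        simp

end

/-! ### Moments of the product of the multipliers -/

lemma one_le_multiplier {Ω : Type*} (W : ℝ≥0 → Ω → ℝ) {ρ : ℝ} (hρ : 0 ≤ ρ) (σ : ℝ) (τ : ℝ≥0)
    (i : ℕ) (ω : Ω) :
    1 ≤ multiplier W ρ σ τ i ω := by
  unfold multiplier
  have := Real.exp_pos (σ * W ((i : ℝ≥0) * τ) ω - 1 / 2 * σ ^ 2 * ((i : ℝ) * (τ : ℝ)))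
  nlinarith

section Brownian

variable {Ω : Type*} [MeasurableSpace Ω] {μ : Measure Ω} {W : ℝ≥0 → Ω → ℝ}

lemma aemeasurable_multiplier (hW : IsPreBrownianReal W μ) (ρ σ : ℝ) (τ : ℝ≥0) (i : ℕ) :
    AEMeasurable (multiplier W ρ σ τ i) μ := by
  have := hW.aemeasurable ((i : ℝ≥0) * τ)
  unfold multiplier
  fun_prop

/-- Exponential moments of linear combinations of the increments of a Brownian motion. -/
lemma integral_exp_sum_increments (hW : IsPreBrownianReal W μ) (σ : ℝ) (τ : ℝ≥0) (n : ℕ)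
    (s : ℕ → ℝ) :
    ∫ ω, Real.exp (σ * ∑ m ∈ Finset.range n,
        s m * (W ((m + 1 : ℕ) * τ) ω - W ((m : ℕ) * τ) ω)) ∂μ =
      Real.exp (1 / 2 * σ ^ 2 * τ * ∑ m ∈ Finset.range n, s m ^ 2) := by
  have hmono : Monotone fun m : ℕ => (m : ℝ≥0) * τ := fun a b hab => by
    have : (a : ℝ≥0) ≤ b := by exact_mod_cast hab
    exact mul_le_mul' this le_rfl
  have hind := (hW.hasIndepIncrements.nat hmono).comp (fun m x => s m * x)
    (fun m => measurable_const_mul (s m))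
  have hmeas : ∀ m : ℕ, AEMeasurable ((fun x => s m * x) ∘
      fun ω => W ((m + 1 : ℕ) * τ) ω - W ((m : ℕ) * τ) ω) μ := fun m =>
    ((hW.aemeasurable _).sub (hW.aemeasurable _)).const_mul _
  have h := hind.mgf_sum₀ (t := σ) hmeas (Finset.range n)
  have hl : mgf (∑ m ∈ Finset.range n, ((fun x => s m * x) ∘
      fun ω => W ((m + 1 : ℕ) * τ) ω - W ((m : ℕ) * τ) ω)) μ σ =
      ∫ ω, Real.exp (σ * ∑ m ∈ Finset.range n,
        s m * (W ((m + 1 : ℕ) * τ) ω - W ((m : ℕ) * τ) ω)) ∂μ := by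
    simp [mgf, Finset.sum_apply]
  rw [← hl, h, Finset.mul_sum, Real.exp_sum]
  refine Finset.prod_congr rfl fun m _ => ?_
  have hlaw : μ.map (fun ω => W ((m + 1 : ℕ) * τ) ω - W ((m : ℕ) * τ) ω) = gaussianReal 0 τ := by
    have h1 := (hW.hasLaw_sub ((m + 1 : ℕ) * τ) ((m : ℕ) * τ)).map_eq
    have h2 : nndist (((m + 1 : ℕ) * τ : ℝ≥0) : ℝ) (((m : ℕ) * τ : ℝ≥0) : ℝ) = τ := by
      ext
      rw [coe_nndist, Real.dist_eq]
      push_cast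
      rw [show ((m : ℝ) + 1) * τ - m * τ = τ by ring]
      exact abs_of_nonneg τ.2
    rw [show (((m + 1 : ℕ) * τ : ℝ≥0)).1 = (((m + 1 : ℕ) * τ : ℝ≥0) : ℝ) from rfl,
      show (((m : ℕ) * τ : ℝ≥0)).1 = (((m : ℕ) * τ : ℝ≥0) : ℝ) from rfl, h2] at h1
    exact h1
  have := mgf_gaussianReal hlaw (σ * s m)
  rw [mgf] at this ⊢
  simp only [Function.comp_apply, ← mul_assoc]
  rw [this]
  congr 1
  ring

/-- Each `W (t_i)` is a telescoping sum of increments, almost surely only because `W 0 = 0` holds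
almost surely. Exchanging sums makes the tail sums the coefficients of the increments. -/
lemma ae_sum_mul_eq (hW : IsPreBrownianReal W μ) (σ : ℝ) (τ : ℝ≥0) {n : ℕ} (k : Fin n → ℕ) :
    ∀ᵐ ω ∂μ, ∑ i : Fin n, (k i : ℝ) *
        (σ * W (((i : ℕ) : ℝ≥0) * τ) ω - 1 / 2 * σ ^ 2 * (((i : ℕ) : ℝ) * (τ : ℝ))) =
      σ * ∑ m ∈ Finset.range n,
        (tailSum k m : ℝ) * (W ((m + 1 : ℕ) * τ) ω - W ((m : ℕ) * τ) ω) -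
      1 / 2 * σ ^ 2 * τ * ∑ m ∈ Finset.range n, (tailSum k m : ℝ) := by
  filter_upwards [hW.eval_zero_ae_eq_zero] with ω h0
  have hfun : ∀ i : ℕ, σ * W ((i : ℝ≥0) * τ) ω - 1 / 2 * σ ^ 2 * ((i : ℝ) * (τ : ℝ)) =
      ∑ m ∈ Finset.range i, (σ * (W ((m + 1 : ℕ) * τ) ω - W ((m : ℕ) * τ) ω) -
        1 / 2 * σ ^ 2 * τ) := by
    intro i
    rw [Finset.sum_sub_distrib, ← Finset.mul_sum,
      Finset.sum_range_sub (fun m : ℕ => W ((m : ℕ) * τ) ω)]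
    simp only [Nat.cast_zero, zero_mul, h0, Finset.sum_const, Finset.card_range, nsmul_eq_mul]
    ring
  simp_rw [hfun]
  rw [sum_mul_sum_range_eq, Finset.mul_sum, Finset.mul_sum, ← Finset.sum_sub_distrib]
  exact Finset.sum_congr rfl fun m _ => by ring

lemma integrable_prod_multiplier_pow_and_integral_eq (hW : IsPreBrownianReal W μ) (ρ σ : ℝ)
    (τ : ℝ≥0) (q n : ℕ) :
    Integrable (fun ω => (∏ i ∈ Finset.range n, multiplier W ρ σ τ i ω) ^ q) μ ∧
    ∫ ω, (∏ i ∈ Finset.range n, multiplier W ρ σ τ i ω) ^ q ∂μ =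
      ∑ k ∈ multiIndices q n, weight ρ q k * Real.exp (1 / 2 * σ ^ 2 * τ *
        ∑ m ∈ Finset.range n, ((tailSum k m : ℝ) ^ 2 - tailSum k m)) := by
  have hexp : ∀ ω, (∏ i ∈ Finset.range n, multiplier W ρ σ τ i ω) ^ q =
      ∑ k ∈ multiIndices q n, weight ρ q k * Real.exp (∑ i : Fin n, (k i : ℝ) *
        (σ * W (((i : ℕ) : ℝ≥0) * τ) ω - 1 / 2 * σ ^ 2 * (((i : ℕ) : ℝ) * (τ : ℝ)))) := by
    intro ω
    rw [← Finset.prod_pow]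
    exact prod_one_add_mul_exp_pow ρ q n
      (fun i => σ * W ((i : ℝ≥0) * τ) ω - 1 / 2 * σ ^ 2 * ((i : ℝ) * (τ : ℝ)))
  have hint : ∀ k : Fin n → ℕ, ∫ ω, Real.exp (∑ i : Fin n, (k i : ℝ) *
        (σ * W (((i : ℕ) : ℝ≥0) * τ) ω - 1 / 2 * σ ^ 2 * (((i : ℕ) : ℝ) * (τ : ℝ)))) ∂μ =
      Real.exp (1 / 2 * σ ^ 2 * τ *
        ∑ m ∈ Finset.range n, ((tailSum k m : ℝ) ^ 2 - tailSum k m)) := by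
    intro k
    have h1 : (fun ω => Real.exp (∑ i : Fin n, (k i : ℝ) *
        (σ * W (((i : ℕ) : ℝ≥0) * τ) ω - 1 / 2 * σ ^ 2 * (((i : ℕ) : ℝ) * (τ : ℝ))))) =ᵐ[μ]
        fun ω => Real.exp (σ * ∑ m ∈ Finset.range n,
          (tailSum k m : ℝ) * (W ((m + 1 : ℕ) * τ) ω - W ((m : ℕ) * τ) ω)) *
          Real.exp (-(1 / 2 * σ ^ 2 * τ * ∑ m ∈ Finset.range n, (tailSum k m : ℝ))) := by
      filter_upwards [ae_sum_mul_eq hW σ τ k] with ω hω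
      rw [hω, sub_eq_add_neg, Real.exp_add]
    rw [integral_congr_ae h1, integral_mul_const, integral_exp_sum_increments hW, ← Real.exp_add,
      Finset.sum_sub_distrib]
    congr 1
    ring
  have hintg : ∀ k : Fin n → ℕ, Integrable (fun ω => Real.exp (∑ i : Fin n, (k i : ℝ) *
        (σ * W (((i : ℕ) : ℝ≥0) * τ) ω - 1 / 2 * σ ^ 2 * (((i : ℕ) : ℝ) * (τ : ℝ))))) μ := by
    intro k
    -- A non-integrable function has Bochner integral zero, so the positive value just computed
    -- yields integrability.
    refine Integrable.of_integral_ne_zero ?_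
    rw [hint k]
    exact (Real.exp_pos _).ne'
  simp_rw [hexp]
  refine ⟨integrable_finsetSum _ fun k _ => (hintg k).const_mul _, ?_⟩
  rw [integral_finsetSum _ fun k _ => (hintg k).const_mul _]
  refine Finset.sum_congr rfl fun k _ => ?_
  rw [integral_const_mul, hint k]

lemma integral_prod_multiplier_pow_le (hW : IsPreBrownianReal W μ) {ρ : ℝ} (hρ : 0 ≤ ρ) (σ : ℝ)
    (τ : ℝ≥0) (q n : ℕ) :
    ∫ ω, (∏ i ∈ Finset.range n, multiplier W ρ σ τ i ω) ^ q ∂μ ≤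
      partitionFun ρ (1 / 2 * σ ^ 2 * τ) q n := by
  rw [(integrable_prod_multiplier_pow_and_integral_eq hW ρ σ τ q n).2]
  refine Finset.sum_le_sum fun k _ => mul_le_mul_of_nonneg_left ?_ (weight_nonneg hρ q k)
  have : (0 : ℝ) ≤ 1 / 2 * σ ^ 2 * τ := by positivity
  gcongr with m
  linarith [(Nat.cast_nonneg (tailSum k m) : (0 : ℝ) ≤ _)]

/-- Each of the `n` tail sums is at most `qn`, so the linear term is at most `c n² q`, which is `βq`
in the scaling regime. -/
lemma le_integral_prod_multiplier_pow (hW : IsPreBrownianReal W μ) {ρ : ℝ} (hρ : 0 ≤ ρ) (σ : ℝ)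
    (τ : ℝ≥0) (q n : ℕ) :
    Real.exp (-(1 / 2 * σ ^ 2 * τ * n ^ 2 * q)) * partitionFun ρ (1 / 2 * σ ^ 2 * τ) q n ≤
      ∫ ω, (∏ i ∈ Finset.range n, multiplier W ρ σ τ i ω) ^ q ∂μ := by
  rw [(integrable_prod_multiplier_pow_and_integral_eq hW ρ σ τ q n).2, partitionFun,
    Finset.mul_sum]
  refine Finset.sum_le_sum fun k hk => ?_
  rw [mul_left_comm, ← Real.exp_add]
  refine mul_le_mul_of_nonneg_left (Real.exp_le_exp.2 ?_) (weight_nonneg hρ q k)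
  have hc : (0 : ℝ) ≤ 1 / 2 * σ ^ 2 * τ := by positivity
  have hs : ∑ m ∈ Finset.range n, (tailSum k m : ℝ) ≤ n ^ 2 * q := by
    refine (Finset.sum_le_card_nsmul _ _ ((q : ℝ) * n) fun m _ => ?_).trans (le_of_eq ?_)
    · exact_mod_cast tailSum_le hk m
    · simp only [Finset.card_range, nsmul_eq_mul]
      ring
  rw [Finset.sum_sub_distrib]
  nlinarith [mul_le_mul_of_nonneg_left hs hc]

end Brownian

/-! ### Pathwise comparison with the recursion without noise -/

section Recursion

lemma recursion_zero_right (x₀ : ℝ) (a : ℕ → ℝ) (n : ℕ) :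
    recursion x₀ a (fun _ => 0) n = x₀ * ∏ i ∈ Finset.range n, a i := by
  induction n with
  | zero => simp [recursion]
  | succ n ih => rw [recursion, ih, Finset.prod_range_succ]; ring

lemma recursion_zero_right_le {x₀ : ℝ} {a b : ℕ → ℝ} (ha : ∀ i, 1 ≤ a i) (hb : ∀ i, 0 ≤ b i)
    (n : ℕ) : recursion x₀ a (fun _ => 0) n ≤ recursion x₀ a b n := by
  induction n with
  | zero => exact le_rfl
  | succ n ih =>
    rw [recursion, recursion, add_zero]
    exact (mul_le_mul_of_nonneg_left ih (zero_le_one.trans (ha n))).trans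
      (le_add_of_nonneg_right (hb n))

/-- In the solution, `b_i` is multiplied by the later `a_j` only. Since all `a_j ≥ 1`, this is at
most the full product. -/
lemma recursion_le {x₀ : ℝ} {a b : ℕ → ℝ} (ha : ∀ i, 1 ≤ a i) (hb : ∀ i, 0 ≤ b i) (n : ℕ) :
    recursion x₀ a b n ≤ (∏ i ∈ Finset.range n, a i) * (x₀ + ∑ i ∈ Finset.range n, b i) := by
  induction n with
  | zero => simp [recursion]
  | succ n ih =>
    rw [recursion, Finset.prod_range_succ, Finset.sum_range_succ]
    have h1 : 1 ≤ (∏ i ∈ Finset.range n, a i) * a n := by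
      rw [← Finset.prod_range_succ]
      exact Finset.one_le_prod (fun i _ => ha i)
    have h2 := mul_le_mul_of_nonneg_left ih (zero_le_one.trans (ha n))
    nlinarith [mul_le_mul_of_nonneg_right h1 (hb n)]

end Recursion

/-! ### Entropy duality and summation by parts -/

lemma mul_log_sub_log_le {a r : ℝ} (ha : 0 < a) (hr : 0 ≤ r) :
    r * (Real.log a - Real.log r) ≤ a - r := by
  rcases hr.eq_or_lt with rfl | hr
  · simpa using ha.le
  · rw [← Real.log_div ha.ne' hr.ne']
    have := mul_le_mul_of_nonneg_left (Real.log_le_sub_one_of_pos (div_pos ha hr)) hr.le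
    rwa [mul_sub, mul_one, mul_div_cancel₀ _ hr.ne'] at this

/-- The Gibbs inequality for a Bernoulli variable. -/
lemma mul_sub_entropyFun_le (u : ℝ) {r : ℝ} (h0 : 0 ≤ r) (h1 : r ≤ 1) :
    r * u - entropyFun r ≤ Real.log (1 + Real.exp u) := by
  have hpos : 0 < 1 + Real.exp u := by positivity
  have ha := mul_log_sub_log_le (a := Real.exp u / (1 + Real.exp u)) (by positivity) h0
  have hb := mul_log_sub_log_le (a := 1 / (1 + Real.exp u)) (by positivity) (sub_nonneg.2 h1)
  rw [Real.log_div (Real.exp_pos u).ne' hpos.ne', Real.log_exp] at ha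
  rw [one_div, Real.log_inv] at hb
  have hs : Real.exp u / (1 + Real.exp u) + (1 + Real.exp u)⁻¹ = 1 := by field_simp; ring
  unfold entropyFun
  nlinarith

/-- The equality case of the Gibbs inequality: the logistic value of `r` is the maximizer. -/
lemma mul_sub_entropyFun_eq (u : ℝ) :
    Real.exp u / (1 + Real.exp u) * u - entropyFun (Real.exp u / (1 + Real.exp u)) =
      Real.log (1 + Real.exp u) := by
  have hpos : 0 < 1 + Real.exp u := by positivity
  have h1 : 1 - Real.exp u / (1 + Real.exp u) = (1 + Real.exp u)⁻¹ := by field_simp; ring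
  rw [entropyFun, h1, Real.log_div (Real.exp_pos u).ne' hpos.ne', Real.log_exp, Real.log_inv]
  field_simp
  ring

lemma measurable_entropyFun : Measurable entropyFun := by
  unfold entropyFun
  fun_prop

lemma sum_mul_sum_range_eq_sum_Ico (n : ℕ) (p f : ℕ → ℝ) :
    ∑ i ∈ Finset.range n, p i * ∑ m ∈ Finset.range i, f m =
      ∑ m ∈ Finset.range n, (∑ i ∈ Finset.Ico (m + 1) n, p i) * f m := by
  induction n with
  | zero => simp
  | succ n ih =>
    rw [Finset.sum_range_succ, ih, Finset.sum_range_succ, Finset.Ico_self, Finset.sum_empty,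
      zero_mul, add_zero, Finset.mul_sum, ← Finset.sum_add_distrib]
    refine Finset.sum_congr rfl fun m hm => ?_
    rw [Finset.sum_Ico_succ_top (by simpa using hm), add_mul]

lemma log_linearizedPartitionFun {ρ : ℝ} (hρ : 0 ≤ ρ) (c : ℝ) (q n : ℕ) (θ : ℕ → ℝ) :
    Real.log (linearizedPartitionFun ρ c q n θ) =
      -(c * ∑ m ∈ Finset.range n, θ m ^ 2) + ∑ i ∈ Finset.range n,
        q * Real.log (1 + ρ * Real.exp (2 * c * ∑ m ∈ Finset.range i, θ m)) := by
  have hpos : ∀ i, 0 < 1 + ρ * Real.exp (2 * c * ∑ m ∈ Finset.range i, θ m) :=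
    fun i => by positivity
  rw [linearizedPartitionFun, Real.log_mul (Real.exp_pos _).ne'
    (Finset.prod_pos fun i _ => pow_pos (hpos i) q).ne', Real.log_exp,
    Real.log_prod fun i _ => (pow_pos (hpos i) q).ne']
  simp only [Real.log_pow]

/-! ### Riemann sums of antitone functions -/

section Riemann

variable {F : ℝ → ℝ} {n : ℕ}

lemma antitoneOn_comp_div (hF : AntitoneOn F (Set.Icc 0 1)) (hn : 0 < n) :
    AntitoneOn (fun x => F (x / n)) (Set.Icc (0 : ℝ) (0 + n)) := by
  have hn' : (0 : ℝ) < n := by exact_mod_cast hn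
  rw [zero_add]
  intro x hx y hy hxy
  exact hF ⟨div_nonneg hx.1 hn'.le, (div_le_one hn').2 hx.2⟩
    ⟨div_nonneg hy.1 hn'.le, (div_le_one hn').2 hy.2⟩ (by gcongr)

lemma integral_comp_div_natCast (F : ℝ → ℝ) (hn : 0 < n) :
    ∫ x in (0 : ℝ)..(0 + n), F (x / n) = n * ∫ x in (0 : ℝ)..1, F x := by
  have hn' : (n : ℝ) ≠ 0 := by exact_mod_cast hn.ne'
  rw [intervalIntegral.integral_comp_div F hn', zero_div, zero_add, div_self hn', smul_eq_mul]

lemma AntitoneOn.mul_integral_le_sum (hF : AntitoneOn F (Set.Icc 0 1)) (hn : 0 < n) :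
    n * ∫ x in (0 : ℝ)..1, F x ≤ ∑ m ∈ Finset.range n, F ((m : ℝ) / n) := by
  have := (antitoneOn_comp_div hF hn).integral_le_sum
  rw [integral_comp_div_natCast F hn] at this
  simpa using this

lemma AntitoneOn.sum_le_mul_integral (hF : AntitoneOn F (Set.Icc 0 1)) (hn : 0 < n) :
    ∑ m ∈ Finset.range n, F (((m + 1 : ℕ) : ℝ) / n) ≤ n * ∫ x in (0 : ℝ)..1, F x := by
  have := (antitoneOn_comp_div hF hn).sum_le_integral
  rw [integral_comp_div_natCast F hn] at this
  simpa using this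

end Riemann

/-! ### Lower bound from admissible functions -/

section Admissible

variable {g : ℝ → ℝ} {q : ℕ}

lemma absolutelyContinuousOnInterval_of_mem_admissible (hg : g ∈ admissible q) {x y : ℝ}
    (hx : x ∈ Set.Icc (0 : ℝ) 1) (hy : y ∈ Set.Icc (0 : ℝ) 1) :
    AbsolutelyContinuousOnInterval g x y := by
  refine hg.1.mono ?_
  rw [Set.uIcc_of_le (zero_le_one' ℝ)]
  exact Set.uIcc_subset_Icc hx hy

lemma ae_deriv_mem_of_mem_admissible (hg : g ∈ admissible q) {x y : ℝ}
    (hx : x ∈ Set.Icc (0 : ℝ) 1) (hy : y ∈ Set.Icc (0 : ℝ) 1) :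
    ∀ᵐ z ∂volume.restrict (Set.Icc x y), deriv g z ∈ Set.Icc (0 : ℝ) q := by
  rw [ae_restrict_iff' measurableSet_Icc]
  have h0 : ∀ᵐ z : ℝ, z ≠ 0 := by simp [ae_iff]
  have h1 : ∀ᵐ z : ℝ, z ≠ 1 := by simp [ae_iff]
  filter_upwards [hg.2.2.2, h0, h1] with z hz hz0 hz1 hzI
  exact hz ⟨lt_of_le_of_ne (hx.1.trans hzI.1) hz0.symm, lt_of_le_of_ne (hzI.2.trans hy.2) hz1⟩

lemma monotoneOn_of_mem_admissible (hg : g ∈ admissible q) : MonotoneOn g (Set.Icc 0 1) := by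
  intro x hx y hy hxy
  rw [← sub_nonneg,
    ← (absolutelyContinuousOnInterval_of_mem_admissible hg hx hy).integral_deriv_eq_sub]
  refine intervalIntegral.integral_nonneg_of_ae_restrict hxy ?_
  filter_upwards [ae_deriv_mem_of_mem_admissible hg hx hy] with z hz using hz.1

lemma antitoneOn_sq_sub_of_mem_admissible (hg : g ∈ admissible q) :
    AntitoneOn (fun x => (g 1 - g x) ^ 2) (Set.Icc 0 1) := by
  intro x hx y hy hxy
  have h1 := monotoneOn_of_mem_admissible hg hx hy hxy
  have h2 := monotoneOn_of_mem_admissible hg hy (Set.right_mem_Icc.2 zero_le_one) hy.2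
  exact pow_le_pow_left₀ (by linarith) (by linarith) 2

lemma intervalIntegrable_entropyFun_of_mem_admissible (hg : g ∈ admissible q) {x y : ℝ}
    (hx : x ∈ Set.Icc (0 : ℝ) 1) (hy : y ∈ Set.Icc (0 : ℝ) 1) (hxy : x ≤ y) :
    IntervalIntegrable (fun z => entropyFun (deriv g z / q)) volume x y := by
  rw [intervalIntegrable_iff_integrableOn_Icc_of_le hxy]
  refine Measure.integrableOn_of_bounded (M := Real.log 2) measure_Icc_lt_top.ne
    (measurable_entropyFun.comp ((measurable_deriv g).div_const _)).aestronglyMeasurable ?_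
  filter_upwards [ae_deriv_mem_of_mem_admissible hg hx hy] with z hz
  exact abs_entropyFun_le (div_nonneg hz.1 (Nat.cast_nonneg q))
    (div_le_one_of_le₀ hz.2 (Nat.cast_nonneg q))

/-- The lower bound for the partition function, obtained by linearizing around the profile of an
admissible function. -/
lemma mul_functional_sub_le_log_partitionFun (hq : 1 ≤ q) (hg : g ∈ admissible q) {ρ β : ℝ}
    (hρ : 0 < ρ) (hβ : 0 ≤ β) {n : ℕ} (hn : 0 < n) :
    n * functional ρ β q g - β * q ^ 2 ≤ Real.log (partitionFun ρ (β / n ^ 2) q n) := by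
  have hn' : (0 : ℝ) < n := by exact_mod_cast hn
  have hq' : (0 : ℝ) < q := by exact_mod_cast hq
  have hc : 0 ≤ β / (n : ℝ) ^ 2 := by positivity
  set c := β / (n : ℝ) ^ 2 with hcdef
  have hcn : c * n ^ 2 = β := by rw [hcdef]; field_simp
  -- The continuum analogue of the tail sum. The index `m + 1` matches the strict inequality `i >
  -- m`, so that summation by parts produces exactly `T m ^ 2`.
  set T : ℕ → ℝ := fun m => n * (g 1 - g (((m + 1 : ℕ) : ℝ) / n)) with hT
  set V : ℕ → ℝ := fun i => 2 * c * ∑ m ∈ Finset.range i, T m with hV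
  have hmem : ∀ i : ℕ, i ≤ n → (i : ℝ) / n ∈ Set.Icc (0 : ℝ) 1 := fun i hi =>
    ⟨by positivity, (div_le_one hn').2 (by exact_mod_cast hi)⟩
  have hle : ∀ i : ℕ, (i : ℝ) / n ≤ ((i + 1 : ℕ) : ℝ) / n := fun i => by
    gcongr; exact_mod_cast Nat.le_succ i
  -- The Gibbs inequality with `r = g' / q` and `u = log ρ + V i`, integrated over one cell, where
  -- `u` is constant.
  have hstep : ∀ i ∈ Finset.range n,
      (g (((i + 1 : ℕ) : ℝ) / n) - g ((i : ℝ) / n)) * (Real.log ρ + V i) -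
        q * ∫ x in ((i : ℝ) / n)..(((i + 1 : ℕ) : ℝ) / n), entropyFun (deriv g x / q) ≤
      1 / n * (q * Real.log (1 + ρ * Real.exp (V i))) := by
    intro i hi
    have hi' := Finset.mem_range.1 hi
    have hx := hmem i hi'.le
    have hy := hmem (i + 1) hi'
    have hac := absolutelyContinuousOnInterval_of_mem_admissible hg hx hy
    have hI := intervalIntegrable_entropyFun_of_mem_admissible hg hx hy (hle i)
    rw [← hac.integral_deriv_eq_sub, ← intervalIntegral.integral_mul_const,
      ← intervalIntegral.integral_const_mul,
      ← intervalIntegral.integral_sub (hac.intervalIntegrable_deriv.mul_const _) (hI.const_mul _)]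
    have hconst : 1 / n * (q * Real.log (1 + ρ * Real.exp (V i))) =
        ∫ _x in ((i : ℝ) / n)..(((i + 1 : ℕ) : ℝ) / n),
          q * Real.log (1 + ρ * Real.exp (V i)) := by
      rw [intervalIntegral.integral_const, smul_eq_mul]
      congr 1
      push_cast
      ring
    rw [hconst]
    refine intervalIntegral.integral_mono_ae_restrict (hle i)
      ((hac.intervalIntegrable_deriv.mul_const _).sub (hI.const_mul _)) (by simp) ?_
    filter_upwards [ae_deriv_mem_of_mem_admissible hg hx hy] with z hz
    have h := mul_sub_entropyFun_le (Real.log ρ + V i) (div_nonneg hz.1 hq'.le)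
      (div_le_one_of_le₀ hz.2 hq'.le)
    rw [Real.exp_add, Real.exp_log hρ] at h
    have h2 := mul_le_mul_of_nonneg_left h hq'.le
    rwa [mul_sub, ← mul_assoc, mul_div_cancel₀ _ hq'.ne'] at h2
  have hsum := Finset.sum_le_sum hstep
  have htel : ∑ i ∈ Finset.range n, (g (((i + 1 : ℕ) : ℝ) / n) - g ((i : ℝ) / n)) = g 1 := by
    rw [Finset.sum_range_sub (fun i : ℕ => g ((i : ℝ) / n)), div_self hn'.ne', Nat.cast_zero,
      zero_div, hg.2.1, sub_zero]
  have hint : ∑ i ∈ Finset.range n,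
      ∫ x in ((i : ℝ) / n)..(((i + 1 : ℕ) : ℝ) / n), entropyFun (deriv g x / q) =
      ∫ x in (0 : ℝ)..1, entropyFun (deriv g x / q) := by
    rw [intervalIntegral.sum_integral_adjacent_intervals (a := fun i : ℕ => (i : ℝ) / n)
      fun i hi => intervalIntegrable_entropyFun_of_mem_admissible hg (hmem i hi.le)
        (hmem (i + 1) hi) (hle i), div_self hn'.ne', Nat.cast_zero, zero_div]
  have hparts : n * ∑ i ∈ Finset.range n,
      (g (((i + 1 : ℕ) : ℝ) / n) - g ((i : ℝ) / n)) * V i =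
      2 * c * ∑ m ∈ Finset.range n, T m ^ 2 := by
    have h1 : ∀ i, (g (((i + 1 : ℕ) : ℝ) / n) - g ((i : ℝ) / n)) * V i =
        (g (((i + 1 : ℕ) : ℝ) / n) - g ((i : ℝ) / n)) *
          ∑ m ∈ Finset.range i, (2 * c * T m) := fun i => by simp only [hV, Finset.mul_sum]
    simp_rw [h1]
    rw [sum_mul_sum_range_eq_sum_Ico, Finset.mul_sum, Finset.mul_sum]
    refine Finset.sum_congr rfl fun m hm => ?_
    rw [Finset.sum_Ico_sub (fun i : ℕ => g ((i : ℝ) / n)) (Finset.mem_range.1 hm),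
      div_self hn'.ne']
    simp only [hT]
    ring
  -- Left-endpoint sums dominate the integral; passing to right endpoints removes the term `g 1 ^ 2
  -- ≤ q ^ 2` at `0` and adds a zero term at `1`.
  have hriem : β * (n * ∫ x in (0 : ℝ)..1, (g 1 - g x) ^ 2) - β * q ^ 2 ≤
      c * ∑ m ∈ Finset.range n, T m ^ 2 := by
    have h1 := AntitoneOn.mul_integral_le_sum (antitoneOn_sq_sub_of_mem_admissible hg) hn
    have h2 : ∑ m ∈ Finset.range n, (g 1 - g ((m : ℝ) / n)) ^ 2 =
        ∑ m ∈ Finset.range n, (g 1 - g (((m + 1 : ℕ) : ℝ) / n)) ^ 2 + g 1 ^ 2 := by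
      have h3 := Finset.sum_range_succ (fun m : ℕ => (g 1 - g ((m : ℝ) / n)) ^ 2) n
      have h4 := Finset.sum_range_succ' (fun m : ℕ => (g 1 - g ((m : ℝ) / n)) ^ 2) n
      simp only [div_self hn'.ne', Nat.cast_zero, zero_div, hg.2.1] at h3 h4
      linarith
    have h5 : c * ∑ m ∈ Finset.range n, T m ^ 2 =
        β * ∑ m ∈ Finset.range n, (g 1 - g (((m + 1 : ℕ) : ℝ) / n)) ^ 2 := by
      simp only [hT, mul_pow]
      rw [← Finset.mul_sum, ← mul_assoc, hcn]
    have h6 := hg.2.2.1 1 (Set.right_mem_Icc.2 zero_le_one)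
    have h7 : g 1 ^ 2 ≤ (q : ℝ) ^ 2 := pow_le_pow_left₀ h6.1 h6.2 2
    rw [h5, ← mul_sub]
    exact mul_le_mul_of_nonneg_left (by linarith) hβ
  have hlog : Real.log (linearizedPartitionFun ρ c q n T) =
      -(c * ∑ m ∈ Finset.range n, T m ^ 2) +
        ∑ i ∈ Finset.range n, q * Real.log (1 + ρ * Real.exp (V i)) := by
    simpa only [hV] using log_linearizedPartitionFun hρ.le c q n T
  refine le_trans ?_ (Real.log_le_log (linearizedPartitionFun_pos hρ.le c q n T)
    (linearizedPartitionFun_le hρ.le hc q n T))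
  rw [hlog]
  simp only [mul_add] at hsum
  rw [Finset.sum_sub_distrib, Finset.sum_add_distrib, ← Finset.sum_mul, htel, ← Finset.mul_sum,
    hint, ← Finset.mul_sum] at hsum
  have hsum' := mul_le_mul_of_nonneg_left hsum hn'.le
  rw [← mul_assoc, mul_one_div_cancel hn'.ne', one_mul, mul_sub, mul_add, hparts] at hsum'
  unfold functional
  rw [mul_sub, mul_add]
  nlinarith

end Admissible

/-! ### Upper bound from piecewise linear functions -/

section StepFunction

variable {n : ℕ} (Φ : ℕ → ℝ)

lemma intervalIntegrable_comp_floor_mul (n : ℕ) {M : ℝ} (hΦ : ∀ i, |Φ i| ≤ M) (x y : ℝ) :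
    IntervalIntegrable (fun t : ℝ => Φ ⌊(n : ℝ) * t⌋₊) volume x y := by
  rw [intervalIntegrable_iff]
  refine Measure.integrableOn_of_bounded (M := M) measure_Ioc_lt_top.ne ?_
    (Eventually.of_forall fun t => hΦ _)
  have h : Measurable fun t : ℝ => ⌊(n : ℝ) * t⌋₊ :=
    Nat.measurable_floor.comp (measurable_const_mul _)
  exact ((measurable_from_nat (f := Φ)).comp h).aestronglyMeasurable

lemma integral_comp_floor_mul (hn : 0 < n) {M : ℝ} (hΦ : ∀ i, |Φ i| ≤ M) (j : ℕ) :
    ∫ t in (0 : ℝ)..((j : ℝ) / n), Φ ⌊(n : ℝ) * t⌋₊ =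
      1 / n * ∑ i ∈ Finset.range j, Φ i := by
  have hn' : (0 : ℝ) < n := by exact_mod_cast hn
  have hstep : ∀ i : ℕ, ∫ t in ((i : ℝ) / n)..(((i + 1 : ℕ) : ℝ) / n), Φ ⌊(n : ℝ) * t⌋₊ =
      1 / n * Φ i := by
    intro i
    have hle : (i : ℝ) / n ≤ ((i + 1 : ℕ) : ℝ) / n := by
      gcongr; exact_mod_cast Nat.le_succ i
    -- The floor jumps at the right end of the cell, a null set.
    have hne : ∀ᵐ t : ℝ, t ≠ ((i + 1 : ℕ) : ℝ) / n := by simp [ae_iff]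
    have hcongr : ∫ t in ((i : ℝ) / n)..(((i + 1 : ℕ) : ℝ) / n), Φ ⌊(n : ℝ) * t⌋₊ =
        ∫ _t in ((i : ℝ) / n)..(((i + 1 : ℕ) : ℝ) / n), Φ i := by
      refine intervalIntegral.integral_congr_ae ?_
      filter_upwards [hne] with t ht htI
      rw [Set.uIoc_of_le hle] at htI
      have h1 : (i : ℝ) ≤ n * t := by
        have := (div_lt_iff₀ hn').1 htI.1
        linarith
      have h2 : n * t < (i : ℝ) + 1 := by
        have := (lt_div_iff₀ hn').1 (lt_of_le_of_ne htI.2 ht)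
        push_cast at this
        linarith
      rw [(Nat.floor_eq_iff (h1.trans' (Nat.cast_nonneg i))).2 ⟨h1, h2⟩]
    rw [hcongr, intervalIntegral.integral_const, smul_eq_mul]
    congr 1
    push_cast
    ring
  have h := intervalIntegral.sum_integral_adjacent_intervals (a := fun i : ℕ => (i : ℝ) / n)
    (f := fun t : ℝ => Φ ⌊(n : ℝ) * t⌋₊) (μ := volume) (n := j)
    fun i _ => intervalIntegrable_comp_floor_mul Φ n hΦ _ _
  simp only [Nat.cast_zero, zero_div] at h
  rw [← h, Finset.mul_sum]
  exact Finset.sum_congr rfl fun i _ => hstep i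

end StepFunction

/-- The piecewise linear function with slopes `p_0, p_1, …` on the intervals `[i/n, (i+1)/n]`. -/
noncomputable def piecewiseLinear (n : ℕ) (p : ℕ → ℝ) (x : ℝ) : ℝ :=
  ∫ t in (0 : ℝ)..x, p ⌊(n : ℝ) * t⌋₊

section PiecewiseLinear

variable {n q : ℕ} {p : ℕ → ℝ}

lemma ae_deriv_piecewiseLinear (n : ℕ) (hp : ∀ i, p i ∈ Set.Icc (0 : ℝ) q) :
    ∀ᵐ x : ℝ, x ∈ Set.uIcc (0 : ℝ) 1 →
      deriv (piecewiseLinear n p) x = p ⌊(n : ℝ) * x⌋₊ := by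
  have hM : ∀ i, |p i| ≤ (q : ℝ) := fun i => by rw [abs_of_nonneg (hp i).1]; exact (hp i).2
  filter_upwards [(intervalIntegrable_comp_floor_mul p n hM 0 1).ae_hasDerivAt_integral]
    with x hx hxI
  exact (hx hxI 0 Set.left_mem_uIcc).deriv

lemma piecewiseLinear_mem_admissible (n : ℕ) (hp : ∀ i, p i ∈ Set.Icc (0 : ℝ) q) :
    piecewiseLinear n p ∈ admissible q := by
  have hM : ∀ i, |p i| ≤ (q : ℝ) := fun i => by rw [abs_of_nonneg (hp i).1]; exact (hp i).2
  refine ⟨?_, by simp [piecewiseLinear], fun x hx => ⟨?_, ?_⟩, ?_⟩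
  · exact (intervalIntegrable_comp_floor_mul p n hM 0 1
      ).absolutelyContinuousOnInterval_intervalIntegral Set.left_mem_uIcc
  · exact intervalIntegral.integral_nonneg hx.1 fun t _ => (hp _).1
  · have h := intervalIntegral.integral_mono_on hx.1
      (intervalIntegrable_comp_floor_mul p n hM 0 x) intervalIntegrable_const
      (g := fun _ => (q : ℝ)) fun t _ => (hp _).2
    rw [intervalIntegral.integral_const, sub_zero, smul_eq_mul] at h
    exact h.trans (mul_le_of_le_one_left (Nat.cast_nonneg q) hx.2)
  · filter_upwards [ae_deriv_piecewiseLinear n hp] with x hx hxI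
    rw [hx (by rw [Set.uIcc_of_le zero_le_one]; exact Set.Ioo_subset_Icc_self hxI)]
    exact hp _

lemma piecewiseLinear_natCast_div (hn : 0 < n) (hp : ∀ i, p i ∈ Set.Icc (0 : ℝ) q) (j : ℕ) :
    piecewiseLinear n p ((j : ℝ) / n) = 1 / n * ∑ i ∈ Finset.range j, p i :=
  integral_comp_floor_mul p hn (M := q)
    (fun i => by rw [abs_of_nonneg (hp i).1]; exact (hp i).2) j

lemma integral_entropyFun_deriv_piecewiseLinear (hn : 0 < n)
    (hp : ∀ i, p i ∈ Set.Icc (0 : ℝ) q) :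
    ∫ x in (0 : ℝ)..1, entropyFun (deriv (piecewiseLinear n p) x / q) =
      1 / n * ∑ i ∈ Finset.range n, entropyFun (p i / q) := by
  have hn' : (n : ℝ) ≠ 0 := by exact_mod_cast hn.ne'
  have h := integral_comp_floor_mul (fun i => entropyFun (p i / q)) hn (M := Real.log 2)
    (fun i => abs_entropyFun_le (div_nonneg (hp i).1 (Nat.cast_nonneg q))
      (div_le_one_of_le₀ (hp i).2 (Nat.cast_nonneg q))) n
  rw [div_self hn'] at h
  rw [← h]
  refine intervalIntegral.integral_congr_ae ?_
  filter_upwards [ae_deriv_piecewiseLinear n hp] with x hx hxI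
  rw [hx (Set.uIoc_subset_uIcc hxI)]

end PiecewiseLinear

/-- Every linearized partition function is bounded by the value of the functional at a piecewise
linear admissible function. -/
lemma log_linearizedPartitionFun_le {q n : ℕ} (hq : 1 ≤ q) {ρ β : ℝ} (hρ : 0 < ρ) (hβ : 0 ≤ β)
    (hn : 0 < n) (θ : ℕ → ℝ) :
    Real.log (linearizedPartitionFun ρ (β / n ^ 2) q n θ) ≤ n * lyapunovExponent ρ β q := by
  have hn' : (0 : ℝ) < n := by exact_mod_cast hn
  have hq' : (0 : ℝ) < q := by exact_mod_cast hq
  have hc : 0 ≤ β / (n : ℝ) ^ 2 := by positivity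
  set c := β / (n : ℝ) ^ 2 with hcdef
  have hcn : β = c * n ^ 2 := by rw [hcdef]; field_simp
  set V : ℕ → ℝ := fun i => 2 * c * ∑ m ∈ Finset.range i, θ m with hV
  -- The Gibbs maximizers for the field `log ρ + V i`, so that no loss occurs in `hlog`.
  set r : ℕ → ℝ := fun i =>
    Real.exp (Real.log ρ + V i) / (1 + Real.exp (Real.log ρ + V i)) with hr
  set p : ℕ → ℝ := fun i => q * r i with hpdef
  have hp : ∀ i, p i ∈ Set.Icc (0 : ℝ) q := fun i => by
    have h0 : 0 ≤ r i := by positivity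
    have h1 : r i ≤ 1 := (div_le_one (by positivity)).2 (by linarith)
    exact ⟨by positivity, mul_le_of_le_one_right hq'.le h1⟩
  have hg := piecewiseLinear_mem_admissible n hp
  have hpr : ∀ i, p i / q = r i := fun i => mul_div_cancel_left₀ _ hq'.ne'
  have hlog : ∀ i, q * Real.log (1 + ρ * Real.exp (V i)) =
      p i * Real.log ρ + p i * V i - q * entropyFun (p i / q) := by
    intro i
    have h := mul_sub_entropyFun_eq (Real.log ρ + V i)
    rw [hpr, hpdef]
    rw [Real.exp_add, Real.exp_log hρ] at h
    rw [← h, hr]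
    simp only [Real.exp_add, Real.exp_log hρ]
    ring
  have hg1 : piecewiseLinear n p 1 = 1 / n * ∑ i ∈ Finset.range n, p i := by
    rw [← piecewiseLinear_natCast_div hn hp n, div_self hn'.ne']
  set P : ℕ → ℝ := fun m => ∑ i ∈ Finset.Ico (m + 1) n, p i with hP
  have hPV : ∑ i ∈ Finset.range n, p i * V i = c * ∑ m ∈ Finset.range n, 2 * P m * θ m := by
    have h1 : ∀ i, p i * V i = p i * ∑ m ∈ Finset.range i, (2 * c * θ m) := fun i => by
      simp only [hV, Finset.mul_sum]
    simp_rw [h1]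
    rw [sum_mul_sum_range_eq_sum_Ico, Finset.mul_sum]
    exact Finset.sum_congr rfl fun m _ => by ring
  -- Here `P m = n (g(1) - g((m+1)/n))` for the piecewise linear `g`. Right-endpoint sums of an
  -- antitone function lie below the integral, so there is no error term.
  have hriem : c * ∑ m ∈ Finset.range n, P m ^ 2 ≤
      β * (n * ∫ x in (0 : ℝ)..1, (piecewiseLinear n p 1 - piecewiseLinear n p x) ^ 2) := by
    have h1 := AntitoneOn.sum_le_mul_integral (antitoneOn_sq_sub_of_mem_admissible hg) hn
    refine le_trans (le_of_eq ?_) (mul_le_mul_of_nonneg_left h1 hβ)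
    rw [hcn, mul_assoc, Finset.mul_sum _ _ ((n : ℝ) ^ 2)]
    congr 1
    refine Finset.sum_congr rfl fun m hm => ?_
    rw [piecewiseLinear_natCast_div hn hp, hg1, ← mul_sub,
      ← Finset.sum_Ico_eq_sub _ (Finset.mem_range.1 hm), mul_pow]
    field_simp
    rfl
  -- The inequality `2Pθ - θ² ≤ P²` replaces the arbitrary profile by the one generated by the
  -- slopes.
  have hsq : c * ∑ m ∈ Finset.range n, 2 * P m * θ m ≤
      c * ∑ m ∈ Finset.range n, P m ^ 2 + c * ∑ m ∈ Finset.range n, θ m ^ 2 := by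
    rw [← mul_add, ← Finset.sum_add_distrib]
    exact mul_le_mul_of_nonneg_left
      (Finset.sum_le_sum fun m _ => two_mul_le_add_sq (P m) (θ m)) hc
  have hsup : functional ρ β q (piecewiseLinear n p) ≤ lyapunovExponent ρ β q :=
    le_csSup (functional_image_bddAbove ρ β q) ⟨_, hg, rfl⟩
  refine le_trans ?_ (mul_le_mul_of_nonneg_left hsup hn'.le)
  rw [log_linearizedPartitionFun hρ.le, Finset.sum_congr rfl fun i _ => hlog i,
    Finset.sum_sub_distrib, Finset.sum_add_distrib, hPV, ← Finset.sum_mul,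
    functional, integral_entropyFun_deriv_piecewiseLinear hn hp]
  have e1 : (n : ℝ) * (piecewiseLinear n p 1 * Real.log ρ) =
      (∑ i ∈ Finset.range n, p i) * Real.log ρ := by
    rw [hg1]; field_simp
  have e2 : (n : ℝ) * (q * (1 / n * ∑ i ∈ Finset.range n, entropyFun (p i / q))) =
      q * ∑ i ∈ Finset.range n, entropyFun (p i / q) := by
    field_simp
  rw [mul_sub, mul_add, e1, e2, mul_left_comm, Finset.mul_sum _ _ (q : ℝ)]
  linarith

/-! ### Asymptotics of the partition function -/

section PartitionFunction

variable {q : ℕ} {ρ β : ℝ} {n : ℕ}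

lemma mul_lyapunovExponent_sub_le_log_partitionFun (hq : 1 ≤ q) (hρ : 0 < ρ) (hβ : 0 ≤ β)
    (hn : 0 < n) :
    n * lyapunovExponent ρ β q - β * q ^ 2 ≤ Real.log (partitionFun ρ (β / n ^ 2) q n) := by
  have hn' : (0 : ℝ) < n := by exact_mod_cast hn
  have h : lyapunovExponent ρ β q ≤
      (Real.log (partitionFun ρ (β / n ^ 2) q n) + β * q ^ 2) / n := by
    refine csSup_le (functional_image_nonempty ρ β q) ?_
    rintro _ ⟨g, hg, rfl⟩
    rw [le_div_iff₀ hn']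
    linarith [mul_functional_sub_le_log_partitionFun hq hg hρ hβ hn]
  rw [le_div_iff₀ hn'] at h
  linarith

/-- Blocks of length `√n` keep the freezing error below `βq²`, while the choice of a profile costs
about `√n` logarithms, which is `o(n)`. -/
lemma log_partitionFun_le (hq : 1 ≤ q) (hρ : 0 < ρ) (hβ : 0 ≤ β) (hn : 0 < n) :
    Real.log (partitionFun ρ (β / n ^ 2) q n) ≤ n * lyapunovExponent ρ β q + β * q ^ 2 +
      (Nat.sqrt n + 3) * Real.log (q * n + 1) := by
  have hn' : (0 : ℝ) < n := by exact_mod_cast hn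
  have hc : 0 ≤ β / (n : ℝ) ^ 2 := by positivity
  have hB : 0 < Nat.sqrt n := Nat.sqrt_pos.2 hn
  have hZ := partitionFun_le_of_linearized_le hρ.le hc hB
    (M := Real.exp (n * lyapunovExponent ρ β q)) (q := q) (n := n) fun θ => by
      rw [← Real.log_le_iff_le_exp (linearizedPartitionFun_pos hρ.le _ q n θ)]
      exact log_linearizedPartitionFun_le hq hρ hβ hn θ
  have hpos : (0 : ℝ) < q * n + 1 := by positivity
  have hlog := Real.log_le_log (partitionFun_pos hρ.le hc q n) hZ
  rw [Real.log_mul (Real.exp_pos _).ne' (by positivity), Real.log_exp,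
    Real.log_mul (by positivity) (Real.exp_pos _).ne', Real.log_exp, Real.log_pow] at hlog
  have h1 : β / (n : ℝ) ^ 2 * (n * (q * Nat.sqrt n : ℝ) ^ 2) ≤ β * q ^ 2 := by
    have h2 : (Nat.sqrt n : ℝ) ^ 2 ≤ n := by exact_mod_cast Nat.sqrt_le' n
    calc β / (n : ℝ) ^ 2 * (n * (q * Nat.sqrt n : ℝ) ^ 2)
        = β * q ^ 2 * ((Nat.sqrt n : ℝ) ^ 2 / n) := by field_simp
      _ ≤ β * q ^ 2 * 1 := by
          refine mul_le_mul_of_nonneg_left ?_ (by positivity)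
          rwa [div_le_one hn']
      _ = β * q ^ 2 := mul_one _
  -- With `s = Nat.sqrt n`, `n ≤ s² + 2s` gives `n / s ≤ s + 2`; the extra block makes `s + 3`.
  have h3 : ((n / Nat.sqrt n + 1 : ℕ) : ℝ) ≤ Nat.sqrt n + 3 := by
    have h4 : n / Nat.sqrt n ≤ Nat.sqrt n + 2 := by
      refine Nat.div_le_of_le_mul ?_
      have := Nat.sqrt_le_add n
      nlinarith
    exact_mod_cast Nat.succ_le_succ h4
  have h5 : 0 ≤ Real.log (q * n + 1) :=
    Real.log_nonneg (by linarith [show (0 : ℝ) ≤ q * n by positivity])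
  linarith [mul_le_mul_of_nonneg_right h3 h5]

lemma tendsto_sqrt_mul_log_div (q : ℕ) :
    Tendsto (fun n : ℕ => (Nat.sqrt n + 3) * Real.log (q * n + 1) / (n : ℝ)) atTop (𝓝 0) := by
  -- The bounds `√n + 3 ≤ 4 n^(1/2)` and `log x ≤ 4 x^(1/4)` give the factor 16 and the exponent
  -- `1/2 + 1/4 - 1 = -1/4`.
  have hlim : Tendsto (fun n : ℕ => 16 * (q + 1 : ℝ) ^ (1 / 4 : ℝ) * (n : ℝ) ^ (-(1 / 4) : ℝ))
      atTop (𝓝 0) := by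
    simpa using ((tendsto_rpow_neg_atTop (show (0 : ℝ) < 1 / 4 by norm_num)).comp
      tendsto_natCast_atTop_atTop).const_mul (16 * (q + 1 : ℝ) ^ (1 / 4 : ℝ))
  refine squeeze_zero' ?_ ?_ hlim
  · filter_upwards with n
    have h5 : 0 ≤ Real.log (q * n + 1) :=
      Real.log_nonneg (by linarith [show (0 : ℝ) ≤ q * n by positivity])
    positivity
  · filter_upwards [eventually_ge_atTop 1] with n hn
    have hn1 : (1 : ℝ) ≤ n := by exact_mod_cast hn
    have hn' : (0 : ℝ) < n := by linarith
    have hs : (Nat.sqrt n : ℝ) + 3 ≤ 4 * (n : ℝ) ^ (1 / 2 : ℝ) := by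
      have h1 : (Nat.sqrt n : ℝ) ≤ √n := Real.nat_sqrt_le_real_sqrt
      have h2 : 1 ≤ √(n : ℝ) := Real.one_le_sqrt.2 hn1
      rw [← Real.sqrt_eq_rpow]
      linarith
    have hl : Real.log (q * n + 1) ≤ 4 * ((q + 1 : ℝ) ^ (1 / 4 : ℝ) * (n : ℝ) ^ (1 / 4 : ℝ)) := by
      have h1 := Real.log_le_rpow_div (x := (q + 1 : ℝ) * n) (ε := 1 / 4) (by positivity)
        (by norm_num)
      rw [Real.mul_rpow (by positivity) hn'.le] at h1
      refine (Real.log_le_log (by positivity) (show (q : ℝ) * n + 1 ≤ (q + 1) * n by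
        linarith)).trans (h1.trans (le_of_eq (by ring)))
    rw [div_le_iff₀ hn']
    have h5 : 0 ≤ Real.log (q * n + 1) :=
      Real.log_nonneg (by linarith [show (0 : ℝ) ≤ q * n by positivity])
    refine (mul_le_mul hs hl h5 (by positivity)).trans (le_of_eq ?_)
    have e1 : (n : ℝ) ^ (1 / 2 : ℝ) * (n : ℝ) ^ (1 / 4 : ℝ) = (n : ℝ) ^ (-(1 / 4) : ℝ) * n := by
      rw [← Real.rpow_add hn', ← Real.rpow_add_one hn'.ne']
      norm_num
    linear_combination 16 * (q + 1 : ℝ) ^ (1 / 4 : ℝ) * e1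

end PartitionFunction

/-! ### Moments with additive noise -/

section Moments

variable {Ω : Type*} [MeasurableSpace Ω] {μ : Measure Ω}

lemma aemeasurable_recursion {a b : ℕ → Ω → ℝ} (ha : ∀ i, AEMeasurable (a i) μ)
    (hb : ∀ i, AEMeasurable (b i) μ) (x₀ : ℝ) (n : ℕ) :
    AEMeasurable (fun ω => recursion x₀ (fun i => a i ω) (fun i => b i ω) n) μ := by
  induction n with
  | zero => exact aemeasurable_const
  | succ n ih => exact ((ha n).mul ih).add (hb n)

/-- The power mean inequality for the `n + 1` terms `x₀, b_0, …, b_{n-1}`. -/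
lemma add_sum_pow_le {x₀ : ℝ} (hx₀ : 0 ≤ x₀) {b : ℕ → ℝ} (hb : ∀ i, 0 ≤ b i) {q : ℕ} (hq : 1 ≤ q)
    (n : ℕ) : (x₀ + ∑ i ∈ Finset.range n, b i) ^ q ≤
      (n + 1 : ℝ) ^ (q - 1) * (x₀ ^ q + ∑ i ∈ Finset.range n, b i ^ q) := by
  have h := pow_sum_le_card_mul_sum_pow (s := Finset.range (n + 1))
    (f := fun i : ℕ => match i with | 0 => x₀ | i + 1 => b i) (fun i _ => by cases i <;> simp [hx₀, hb]) (q - 1)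
  rw [Nat.sub_add_cancel hq, Finset.sum_range_succ', Finset.sum_range_succ', add_comm _ x₀,
    add_comm _ (x₀ ^ q), Finset.card_range] at h
  exact_mod_cast h

variable [IsProbabilityMeasure μ]

lemma integrable_add_sum_pow_and_integral_le {x₀ : ℝ} (hx₀ : 0 ≤ x₀) {b : ℕ → Ω → ℝ}
    (hb_nonneg : ∀ i, ∀ᵐ ω ∂μ, 0 ≤ b i ω) (hb_ident : ∀ i, IdentDistrib (b i) (b 0) μ μ)
    {q : ℕ} (hq : 1 ≤ q) (hbq : Integrable (fun ω => b 0 ω ^ q) μ) (n : ℕ) :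
    Integrable (fun ω => (x₀ + ∑ i ∈ Finset.range n, b i ω) ^ q) μ ∧
    ∫ ω, (x₀ + ∑ i ∈ Finset.range n, b i ω) ^ q ∂μ ≤
      (n + 1 : ℝ) ^ q * (x₀ ^ q + ∫ ω, b 0 ω ^ q ∂μ) := by
  have hident : ∀ i, IdentDistrib (fun ω => b i ω ^ q) (fun ω => b 0 ω ^ q) μ μ := fun i =>
    (hb_ident i).comp (measurable_id.pow_const q)
  have hint : ∀ i, Integrable (fun ω => b i ω ^ q) μ := fun i => (hident i).integrable_iff.2 hbq
  have hdom : Integrable (fun ω =>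
      (n + 1 : ℝ) ^ (q - 1) * (x₀ ^ q + ∑ i ∈ Finset.range n, b i ω ^ q)) μ :=
    ((integrable_const _).add (integrable_finsetSum _ fun i _ => hint i)).const_mul _
  have hle : ∀ᵐ ω ∂μ, (x₀ + ∑ i ∈ Finset.range n, b i ω) ^ q ≤
      (n + 1 : ℝ) ^ (q - 1) * (x₀ ^ q + ∑ i ∈ Finset.range n, b i ω ^ q) := by
    filter_upwards [ae_all_iff.2 hb_nonneg] with ω hω using add_sum_pow_le hx₀ hω hq n
  have hnn : ∀ᵐ ω ∂μ, 0 ≤ (x₀ + ∑ i ∈ Finset.range n, b i ω) ^ q := by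
    filter_upwards [ae_all_iff.2 hb_nonneg] with ω hω
    exact pow_nonneg (add_nonneg hx₀ (Finset.sum_nonneg fun i _ => hω i)) q
  have hm : AEMeasurable (fun ω => (x₀ + ∑ i ∈ Finset.range n, b i ω) ^ q) μ := by
    have := fun i => (hb_ident i).aemeasurable_fst
    fun_prop
  have hI : Integrable (fun ω => (x₀ + ∑ i ∈ Finset.range n, b i ω) ^ q) μ := by
    refine hdom.mono' hm.aestronglyMeasurable ?_
    filter_upwards [hle, hnn] with ω h1 h2
    rwa [Real.norm_of_nonneg h2]
  refine ⟨hI, (integral_mono_ae hI hdom hle).trans ?_⟩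
  rw [integral_const_mul, integral_add (integrable_const _)
    (integrable_finsetSum _ fun i _ => hint i), integral_finsetSum _ fun i _ => hint i,
    Finset.sum_congr rfl fun i _ => (hident i).integral_eq]
  have hM : 0 ≤ ∫ ω, b 0 ω ^ q ∂μ := by
    refine integral_nonneg_of_ae ?_
    filter_upwards [hb_nonneg 0] with ω hω using pow_nonneg hω q
  simp only [integral_const, probReal_univ, one_smul, Finset.sum_const, Finset.card_range,
    nsmul_eq_mul]
  obtain ⟨r, rfl⟩ : ∃ r, q = r + 1 := ⟨q - 1, by omega⟩
  rw [Nat.add_sub_cancel, pow_succ (n + 1 : ℝ), mul_assoc]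
  refine mul_le_mul_of_nonneg_left ?_ (by positivity)
  have : 0 ≤ x₀ ^ (r + 1) := by positivity
  have hn : (0 : ℝ) ≤ n := Nat.cast_nonneg n
  nlinarith [mul_nonneg hn this]

end Moments

section MomentBounds

variable {Ω : Type*} [MeasurableSpace Ω] {μ : Measure Ω}
  {W : ℝ≥0 → Ω → ℝ} {ρ x₀ σ : ℝ} {τ : ℝ≥0} {b : ℕ → Ω → ℝ} {q : ℕ}

lemma integrable_recursion_zero_pow (hW : IsPreBrownianReal W μ) (ρ x₀ σ : ℝ) (τ : ℝ≥0)
    (q n : ℕ) :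
    Integrable (fun ω =>
      recursion x₀ (fun i => multiplier W ρ σ τ i ω) (fun _ => 0) n ^ q) μ := by
  simp_rw [recursion_zero_right, mul_pow]
  exact (integrable_prod_multiplier_pow_and_integral_eq hW ρ σ τ q n).1.const_mul _

lemma integral_recursion_zero_pow (x₀ : ℝ) (q n : ℕ) :
    ∫ ω, recursion x₀ (fun i => multiplier W ρ σ τ i ω) (fun _ => 0) n ^ q ∂μ =
      x₀ ^ q * ∫ ω, (∏ i ∈ Finset.range n, multiplier W ρ σ τ i ω) ^ q ∂μ := by
  simp_rw [recursion_zero_right, mul_pow]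
  exact integral_const_mul _ _

/-- The pathwise sandwich is raised to the power `q` and integrated; independence of multipliers and
noise factorizes the upper bound. -/
lemma integrable_recursion_pow_and_bounds [IsProbabilityMeasure μ]
    (hW : IsPreBrownianReal W μ) (hρ : 0 ≤ ρ)
    (hx₀ : 0 ≤ x₀) (hb_nonneg : ∀ i, ∀ᵐ ω ∂μ, 0 ≤ b i ω)
    (hb_ident : ∀ i, IdentDistrib (b i) (b 0) μ μ)
    (hab : IndepFun (fun ω (i : ℕ) => multiplier W ρ σ τ i ω) (fun ω (i : ℕ) => b i ω) μ)
    (hq : 1 ≤ q) (hbq : Integrable (fun ω => b 0 ω ^ q) μ) (n : ℕ) :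
    Integrable (fun ω =>
      recursion x₀ (fun i => multiplier W ρ σ τ i ω) (fun i => b i ω) n ^ q) μ ∧
    ∫ ω, recursion x₀ (fun i => multiplier W ρ σ τ i ω) (fun _ => 0) n ^ q ∂μ ≤
      ∫ ω, recursion x₀ (fun i => multiplier W ρ σ τ i ω) (fun i => b i ω) n ^ q ∂μ ∧
    ∫ ω, recursion x₀ (fun i => multiplier W ρ σ τ i ω) (fun i => b i ω) n ^ q ∂μ ≤
      (∫ ω, (∏ i ∈ Finset.range n, multiplier W ρ σ τ i ω) ^ q ∂μ) *
        ((n + 1 : ℝ) ^ q * (x₀ ^ q + ∫ ω, b 0 ω ^ q ∂μ)) := by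
  have hA := (integrable_prod_multiplier_pow_and_integral_eq hW ρ σ τ q n).1
  obtain ⟨hB, hBle⟩ :=
    integrable_add_sum_pow_and_integral_le hx₀ hb_nonneg hb_ident hq hbq n
  have hindep : IndepFun (fun ω => (∏ i ∈ Finset.range n, multiplier W ρ σ τ i ω) ^ q)
      (fun ω => (x₀ + ∑ i ∈ Finset.range n, b i ω) ^ q) μ :=
    hab.comp (φ := fun a : ℕ → ℝ => (∏ i ∈ Finset.range n, a i) ^ q)
      (ψ := fun b : ℕ → ℝ => (x₀ + ∑ i ∈ Finset.range n, b i) ^ q) (by fun_prop) (by fun_prop)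
  have hAB := hindep.integrable_mul hA hB
  have hABint := hindep.integral_mul_eq_mul_integral hA.aestronglyMeasurable
    hB.aestronglyMeasurable
  have ha := fun ω i => one_le_multiplier W hρ σ τ i ω
  have hy0 : ∀ ω, 0 ≤ recursion x₀ (fun i => multiplier W ρ σ τ i ω) (fun _ => 0) n := by
    intro ω
    rw [recursion_zero_right]
    exact mul_nonneg hx₀ (Finset.prod_nonneg fun i _ => zero_le_one.trans (ha ω i))
  have hlow : ∀ᵐ ω ∂μ, recursion x₀ (fun i => multiplier W ρ σ τ i ω) (fun _ => 0) n ≤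
      recursion x₀ (fun i => multiplier W ρ σ τ i ω) (fun i => b i ω) n := by
    filter_upwards [ae_all_iff.2 hb_nonneg] with ω hω
    exact recursion_zero_right_le (ha ω) hω n
  have hup : ∀ᵐ ω ∂μ,
      recursion x₀ (fun i => multiplier W ρ σ τ i ω) (fun i => b i ω) n ^ q ≤
      ((fun ω => (∏ i ∈ Finset.range n, multiplier W ρ σ τ i ω) ^ q) *
        fun ω => (x₀ + ∑ i ∈ Finset.range n, b i ω) ^ q) ω := by
    filter_upwards [ae_all_iff.2 hb_nonneg, hlow] with ω hω hl
    rw [Pi.mul_apply, ← mul_pow]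
    exact pow_le_pow_left₀ ((hy0 ω).trans hl) (recursion_le (ha ω) hω n) q
  have hX : Integrable (fun ω =>
      recursion x₀ (fun i => multiplier W ρ σ τ i ω) (fun i => b i ω) n ^ q) μ := by
    refine hAB.mono' ((aemeasurable_recursion (fun i => aemeasurable_multiplier hW ρ σ τ i)
      (fun i => (hb_ident i).aemeasurable_fst) x₀ n).pow_const q).aestronglyMeasurable ?_
    filter_upwards [hlow, hup] with ω hl hu
    rwa [Real.norm_of_nonneg (pow_nonneg ((hy0 ω).trans hl) q)]
  refine ⟨hX, ?_, ?_⟩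
  · refine integral_mono_ae (integrable_recursion_zero_pow hW ρ x₀ σ τ q n) hX ?_
    filter_upwards [hlow] with ω hl using pow_le_pow_left₀ (hy0 ω) hl q
  · refine (integral_mono_ae hX hAB hup).trans ?_
    rw [hABint]
    refine mul_le_mul_of_nonneg_left hBle (integral_nonneg fun ω => ?_)
    exact pow_nonneg (Finset.prod_nonneg fun i _ => zero_le_one.trans (ha ω i)) q

/-- In the lower bound, `βq²` is the Riemann sum error and `βq` the cost of the linear term. In the
upper bound, `βq²` comes from freezing on blocks and the last term counts profiles. -/
lemma log_integral_prod_multiplier_pow_bounds (hW : IsPreBrownianReal W μ) (hρ : 0 < ρ)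
    (hq : 1 ≤ q) {β : ℝ} {n : ℕ} (hn : 0 < n)
    (hβ : 1 / 2 * σ ^ 2 * (τ : ℝ) * (n : ℝ) ^ 2 = β) :
    0 < ∫ ω, (∏ i ∈ Finset.range n, multiplier W ρ σ τ i ω) ^ q ∂μ ∧
    n * lyapunovExponent ρ β q - β * q ^ 2 - β * q ≤
      Real.log (∫ ω, (∏ i ∈ Finset.range n, multiplier W ρ σ τ i ω) ^ q ∂μ) ∧
    Real.log (∫ ω, (∏ i ∈ Finset.range n, multiplier W ρ σ τ i ω) ^ q ∂μ) ≤
      n * lyapunovExponent ρ β q + β * q ^ 2 + (Nat.sqrt n + 3) * Real.log (q * n + 1) := by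
  have hn' : (0 : ℝ) < n := by exact_mod_cast hn
  have hβ0 : 0 ≤ β := by rw [← hβ]; positivity
  have hc : 1 / 2 * σ ^ 2 * (τ : ℝ) = β / (n : ℝ) ^ 2 := by rw [← hβ]; field_simp
  have hZ : 0 < partitionFun ρ (β / n ^ 2) q n := partitionFun_pos hρ.le (by positivity) q n
  have hlow := le_integral_prod_multiplier_pow hW hρ.le σ τ q n
  have hup := integral_prod_multiplier_pow_le hW hρ.le σ τ q n
  rw [hβ, hc] at hlow
  rw [hc] at hup
  have hpos := (mul_pos (Real.exp_pos _) hZ).trans_le hlow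
  refine ⟨hpos, ?_, (Real.log_le_log hpos hup).trans (log_partitionFun_le hq hρ hβ0 hn)⟩
  have h := Real.log_le_log (mul_pos (Real.exp_pos _) hZ) hlow
  rw [Real.log_mul (Real.exp_pos _).ne' hZ.ne', Real.log_exp] at h
  linarith [mul_lyapunovExponent_sub_le_log_partitionFun hq hρ hβ0 hn]

end MomentBounds

end LinRec

/-- For every `n ≥ 1`, `x_n` is the `n`-th term of the recursion with parameters `σ n`, `τ n`
satisfying `½ (σ n)² (τ n) n² = β`; the limit `n → ∞` is taken at fixed `β`. -/
theorem mainTheorem3 {Ω : Type*} [MeasurableSpace Ω] (μ : Measure Ω) [IsProbabilityMeasure μ]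
    (W : ℝ≥0 → Ω → ℝ) (hW : IsBrownianReal W μ)
    (ρ : ℝ) (hρ : 0 < ρ) (x₀ : ℝ) (hx₀ : 0 < x₀)
    (β : ℝ) (σ : ℕ → ℝ) (τ : ℕ → ℝ≥0)
    (hστ : ∀ n : ℕ, 1 ≤ n →
      0 < σ n ∧ 0 < τ n ∧ 1 / 2 * σ n ^ 2 * (τ n : ℝ) * (n : ℝ) ^ 2 = β)
    (b : ℕ → Ω → ℝ) (hb_nonneg : ∀ i, ∀ᵐ ω ∂μ, 0 ≤ b i ω)
    (hb_indep : iIndepFun b μ) (hb_ident : ∀ i, IdentDistrib (b i) (b 0) μ μ)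
    (hab : ∀ n : ℕ, 1 ≤ n →
      IndepFun (fun ω (i : ℕ) => LinRec.multiplier W ρ (σ n) (τ n) i ω)
        (fun ω (i : ℕ) => b i ω) μ)
    (q : ℕ) (hq : 1 ≤ q) (hbq : Integrable (fun ω => b 0 ω ^ q) μ) :
    let x : ℕ → Ω → ℝ := fun n ω =>
      LinRec.recursion x₀ (fun i => LinRec.multiplier W ρ (σ n) (τ n) i ω) (fun i => b i ω) n
    let y : ℕ → Ω → ℝ := fun n ω =>
      LinRec.recursion x₀ (fun i => LinRec.multiplier W ρ (σ n) (τ n) i ω) (fun _ => 0) n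
    (∀ n : ℕ, 1 ≤ n → Integrable (fun ω => x n ω ^ q) μ ∧ Integrable (fun ω => y n ω ^ q) μ) ∧
    Tendsto (fun n : ℕ => 1 / (n : ℝ) * Real.log (∫ ω, x n ω ^ q ∂μ)) atTop
      (𝓝 (LinRec.lyapunovExponent ρ β q)) ∧
    Tendsto (fun n : ℕ => 1 / (n : ℝ) * Real.log (∫ ω, y n ω ^ q ∂μ)) atTop
      (𝓝 (LinRec.lyapunovExponent ρ β q)) := by

  intro x y
  have hWp := hW.toIsPreBrownianReal
  have hX : ∀ n : ℕ, 1 ≤ n → _ := fun n hn =>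
    LinRec.integrable_recursion_pow_and_bounds hWp hρ.le hx₀.le hb_nonneg hb_ident (hab n hn) hq
      hbq n
  have hA : ∀ n : ℕ, 1 ≤ n → _ := fun n hn =>
    LinRec.log_integral_prod_multiplier_pow_bounds (μ := μ) hWp hρ hq hn (hστ n hn).2.2
  refine ⟨fun n hn => ⟨(hX n hn).1, LinRec.integrable_recursion_zero_pow hWp ρ x₀ _ _ q n⟩, ?_⟩
  set M := ∫ ω, b 0 ω ^ q ∂μ with hM
  have hM0 : 0 ≤ M := by
    refine integral_nonneg_of_ae ?_
    filter_upwards [hb_nonneg 0] with ω hω using pow_nonneg hω q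
  set R : ℕ → ℝ := fun n => (Nat.sqrt n + 3) * Real.log (q * n + 1) with hR
  set L := LinRec.lyapunovExponent ρ β q with hL
  have hq1 : (1 : ℝ) ≤ q := by exact_mod_cast hq
  have hxq : 0 < x₀ ^ q := pow_pos hx₀ q
  have hlow : ∀ n : ℕ, 1 ≤ n →
      0 < ∫ ω, y n ω ^ q ∂μ ∧
      n * L + (Real.log (x₀ ^ q) - β * q ^ 2 - β * q) ≤ Real.log (∫ ω, y n ω ^ q ∂μ) := by
    intro n hn
    obtain ⟨hpos, h, -⟩ := hA n hn
    have he : ∫ ω, y n ω ^ q ∂μ = _ := LinRec.integral_recursion_zero_pow x₀ q n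
    rw [he, Real.log_mul hxq.ne' hpos.ne']
    exact ⟨mul_pos hxq hpos, by linarith⟩
  have hmid : ∀ n : ℕ, 1 ≤ n →
      Real.log (∫ ω, y n ω ^ q ∂μ) ≤ Real.log (∫ ω, x n ω ^ q ∂μ) := fun n hn =>
    Real.log_le_log (hlow n hn).1 (hX n hn).2.1
  -- One `R n` comes from the partition function; the other `q` absorb the logarithm of the noise
  -- factor `(n + 1)^q`.
  have hup : ∀ n : ℕ, 1 ≤ n → Real.log (∫ ω, x n ω ^ q ∂μ) ≤
      n * L + (β * q ^ 2 + Real.log (x₀ ^ q + M)) + (1 + q) * R n := by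
    intro n hn
    obtain ⟨hpos, -, h⟩ := hA n hn
    have h1 := Real.log_le_log ((hlow n hn).1.trans_le (hX n hn).2.1) (hX n hn).2.2
    rw [Real.log_mul hpos.ne' (by positivity), Real.log_mul (by positivity) (by positivity),
      Real.log_pow] at h1
    have h2 : Real.log (n + 1) ≤ R n := by
      have hn0 : (0 : ℝ) ≤ n := Nat.cast_nonneg n
      have h3 : Real.log (n + 1) ≤ Real.log (q * n + 1) :=
        Real.log_le_log (by positivity) (by nlinarith)
      have h4 : 0 ≤ Real.log ((n : ℝ) + 1) := Real.log_nonneg (by linarith)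
      have h5 : (0 : ℝ) ≤ Nat.sqrt n := Nat.cast_nonneg _
      simp only [hR]
      nlinarith
    have h6 := mul_le_mul_of_nonneg_left h2 (Nat.cast_nonneg q : (0 : ℝ) ≤ q)
    simp only [hR] at h6 ⊢
    linarith
  have hlimlow : Tendsto (fun n : ℕ =>
      L + (Real.log (x₀ ^ q) - β * q ^ 2 - β * q) / (n : ℝ)) atTop (𝓝 L) := by
    simpa using (tendsto_const_div_atTop_nhds_zero_nat _).const_add L
  have hlimup : Tendsto (fun n : ℕ =>
      L + (β * q ^ 2 + Real.log (x₀ ^ q + M)) / (n : ℝ) + (1 + q) * (R n / n)) atTop (𝓝 L) := by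
    simpa using ((tendsto_const_div_atTop_nhds_zero_nat _).const_add L).add
      ((LinRec.tendsto_sqrt_mul_log_div q).const_mul (1 + q : ℝ))
  have hlow' : ∀ n : ℕ, 1 ≤ n → ∀ z : ℝ, n * L + (Real.log (x₀ ^ q) - β * q ^ 2 - β * q) ≤ z →
      L + (Real.log (x₀ ^ q) - β * q ^ 2 - β * q) / (n : ℝ) ≤ 1 / (n : ℝ) * z := by
    intro n hn z hz
    have hn' : (0 : ℝ) < n := by exact_mod_cast hn
    rw [one_div_mul_eq_div, le_div_iff₀ hn', add_mul, div_mul_cancel₀ _ hn'.ne']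
    linarith
  have hup' : ∀ n : ℕ, 1 ≤ n → ∀ z : ℝ,
      z ≤ n * L + (β * q ^ 2 + Real.log (x₀ ^ q + M)) + (1 + q) * R n →
      1 / (n : ℝ) * z ≤
        L + (β * q ^ 2 + Real.log (x₀ ^ q + M)) / (n : ℝ) + (1 + q) * (R n / n) := by
    intro n hn z hz
    have hn' : (0 : ℝ) < n := by exact_mod_cast hn
    rw [one_div_mul_eq_div, div_le_iff₀ hn', add_mul, add_mul, div_mul_cancel₀ _ hn'.ne',
      mul_assoc, div_mul_cancel₀ _ hn'.ne']
    linarith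
  constructor
  · refine tendsto_of_tendsto_of_tendsto_of_le_of_le' hlimlow hlimup ?_ ?_
    · filter_upwards [eventually_ge_atTop 1] with n hn
      exact hlow' n hn _ ((hlow n hn).2.trans (hmid n hn))
    · filter_upwards [eventually_ge_atTop 1] with n hn using hup' n hn _ (hup n hn)
  · refine tendsto_of_tendsto_of_tendsto_of_le_of_le' hlimlow hlimup ?_ ?_
    · filter_upwards [eventually_ge_atTop 1] with n hn using hlow' n hn _ (hlow n hn).2
    · filter_upwards [eventually_ge_atTop 1] with n hn
      exact hup' n hn _ ((hmid n hn).trans (hup n hn))
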